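/- Let $G$ be a virtually free group, that is, a group with a free subgroup of finite index (neither $G$ nor the free subgroup is assumed to be finitely generated). Then $G$ is a Takahasi group: for every ascending chain $H_1 \le H_2 \le H_3 \le \cdots$ of finitely generated subgroups of $G$ for which there is $M \in \mathbb{N}$ with $\mathrm{rk}(H_n) \le M$ for all $n$, there is $p$ such that $H_n = H_p$ for all $n \ge p$. Here $\mathrm{rk}(H) = \min\{|X| : H = \langle X\rangle\}$ is the minimal number of generators of a finitely generated group $H$. -/

import Mathlib

/-- A group is virtually free if it has a free subgroup of finite index. Neither the group nor the
free subgroup is required to be finitely generated. -/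
def IsVirtuallyFree (G : Type*) [Group G] : Prop :=
  ∃ F : Subgroup G, IsFreeGroup F ∧ F.FiniteIndex

/-- A group is a Takahasi group if every ascending chain `H 0 ≤ H 1 ≤ H 2 ≤ ⋯` of finitely
generated subgroups of bounded rank (minimal number of generators) is stationary. -/
def IsTakahasiGroup (G : Type*) [Group G] : Prop :=
  ∀ (H : ℕ → Subgroup G) [∀ n, Group.FG (H n)], Monotone H →
    (∃ M : ℕ, ∀ n, Group.rank (H n) ≤ M) →
      ∃ p : ℕ, ∀ n, p ≤ n → H n = H p

/-! In a free group, the union `L` of the chain is free. Any finite part of a basis of `L` already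
lies in some `H n`, and abelianising over ℚ bounds its size by the rank of `H n`, hence by `M`. So
`L` is finitely generated and equals some `H p`. For finite index, Schreier's bound lets this apply
to the groups `H n ⊓ F`; once these and the cosets of `F` met by `H n` stabilise, so does `H n`. -/

/-- If the image of a homomorphism from a finitely generated group to a rational vector space spans
that space, then the dimension of the space is at most the rank of the group. -/
theorem Group.finrank_le_rank_of_span_range_eq_top {K V : Type*} [Group K] [Group.FG K]
    [AddCommGroup V] [Module ℚ V] (f : K →* Multiplicative V)
    (hf : Submodule.span ℚ (Set.range fun x => (f x).toAdd) = ⊤) :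
    Module.finrank ℚ V ≤ Group.rank K := by
  classical
  obtain ⟨S, hcard, hS⟩ := Group.rank_spec K
  let T : Finset V := S.image fun x => (f x).toAdd
  have hmem : ∀ x : K, (f x).toAdd ∈ Submodule.span ℚ (T : Set V) := by
    intro x
    have hx : x ∈ Subgroup.closure (S : Set K) := hS ▸ Subgroup.mem_top x
    induction hx using Subgroup.closure_induction with
    | mem x hx => exact Submodule.subset_span (Finset.mem_image_of_mem _ hx)
    | one => simp
    | mul x y _ _ hx hy => simpa using add_mem hx hy
    | inv x _ hx => simpa using hx
  have hT : Submodule.span ℚ (T : Set V) = ⊤ := by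
    rw [eq_top_iff, ← hf, Submodule.span_le]
    rintro _ ⟨x, rfl⟩
    exact hmem x
  calc Module.finrank ℚ V = (T : Set V).finrank ℚ := by
        rw [Set.finrank, hT, finrank_top]
    _ ≤ T.card := finrank_span_finset_le_card T
    _ ≤ S.card := Finset.card_image_le
    _ = Group.rank K := hcard

/-- A homomorphism from a group of rank `r` to a free group has at most `r` elements of a given
basis in its range. -/
theorem FreeGroupBasis.card_le_rank_of_mem_range {ι L K : Type*} [Group L] [Group K] [Group.FG K]
    (b : FreeGroupBasis ι L) (g : K →* L) (s : Finset ι) (hs : ∀ i ∈ s, b i ∈ g.range) :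
    s.card ≤ Group.rank K := by
  classical
  -- Basis elements in `s` go to the standard basis vectors, all others to 0.
  let φ : L →* Multiplicative (s → ℚ) :=
    b.lift fun i => Multiplicative.ofAdd fun j => if (j : ι) = i then 1 else 0
  have hφ : ∀ i : s, (φ (b i)).toAdd = Pi.single i (1 : ℚ) := by
    intro i
    ext j
    have hlift : φ (b i) = Multiplicative.ofAdd fun j : s => if (j : ι) = i then (1 : ℚ) else 0 := by
      simp only [φ, FreeGroupBasis.lift_apply_apply, FreeGroupBasis.repr_apply_coe,
        FreeGroup.lift_apply_of]
    rw [hlift, toAdd_ofAdd, Pi.single_apply]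
    simp only [Subtype.ext_iff]
  have hspan : Submodule.span ℚ (Set.range fun x => ((φ.comp g) x).toAdd) = ⊤ := by
    rw [eq_top_iff, ← (Pi.basisFun ℚ s).span_eq, Submodule.span_le]
    rintro _ ⟨i, rfl⟩
    obtain ⟨x, hx⟩ := hs i i.2
    refine Submodule.subset_span ⟨x, ?_⟩
    simp [hx, hφ]
  simpa using Group.finrank_le_rank_of_span_range_eq_top (φ.comp g) hspan

/-- A group with a finite free basis is finitely generated. -/
theorem FreeGroupBasis.fg_of_finite {ι L : Type*} [Group L] [Finite ι] (b : FreeGroupBasis ι L) :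
    Group.FG L :=
  Group.fg_of_surjective (f := b.repr.symm.toMonoidHom) b.repr.symm.surjective

/-- A finite subset of the union of an ascending chain of subgroups lies in one of them. -/
theorem Monotone.exists_finset_subset_subgroup {G : Type*} [Group G] {H : ℕ → Subgroup G}
    (hH : Monotone H) (s : Finset G) (hs : ∀ x ∈ s, x ∈ ⨆ n, H n) :
    ∃ p, ∀ x ∈ s, x ∈ H p := by
  have h : ∀ x ∈ s, ∃ n, x ∈ H n := fun x hx =>
    (Subgroup.mem_iSup_of_directed hH.directed_le).1 (hs x hx)
  choose! n hn using h
  exact ⟨s.sup n, fun x hx => hH (Finset.le_sup hx) (hn x hx)⟩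

/-- Free groups, possibly of infinite rank, are Takahasi groups. -/
theorem IsFreeGroup.isTakahasiGroup (F : Type*) [Group F] [IsFreeGroup F] :
    IsTakahasiGroup F := by
  classical
  rintro H _ hH ⟨M, hM⟩
  let L : Subgroup F := ⨆ n, H n
  -- `L` is free by Nielsen–Schreier.
  let b := IsFreeGroup.basis L
  have hle : ∀ n, H n ≤ L := le_iSup H
  have hcard : ∀ s : Finset (IsFreeGroup.Generators L), s.card ≤ M := by
    intro s
    obtain ⟨p, hp⟩ := hH.exists_finset_subset_subgroup (s.image fun i => (b i : F)) (by
      simp only [Finset.mem_image]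
      rintro _ ⟨i, -, rfl⟩
      exact (b i).2)
    refine (b.card_le_rank_of_mem_range (Subgroup.inclusion (hle p)) s fun i hi => ?_).trans (hM p)
    exact ⟨⟨b i, hp _ (Finset.mem_image_of_mem _ hi)⟩, rfl⟩
  have hfin : Finite (IsFreeGroup.Generators L) := by
    by_contra h
    rw [not_finite_iff_infinite] at h
    obtain ⟨s, hs⟩ := Infinite.exists_subset_card_eq (IsFreeGroup.Generators L) (M + 1)
    have := hcard s
    omega
  obtain ⟨S, hS⟩ := (Group.fg_iff_subgroup_fg L).1 b.fg_of_finite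
  obtain ⟨p, hp⟩ := hH.exists_finset_subset_subgroup S fun x hx =>
    (hS.le (Subgroup.subset_closure hx) : x ∈ L)
  have hLp : L ≤ H p := hS ▸ (Subgroup.closure_le _).2 hp
  exact ⟨p, fun n hn => le_antisymm ((hle n).trans hLp) (hH hn)⟩

/-- The intersections of two subgroups, seen in either of them, are isomorphic. -/
def Subgroup.subgroupOfSwapEquiv {G : Type*} [Group G] (H K : Subgroup G) :
    H.subgroupOf K ≃* K.subgroupOf H where
  toFun x := ⟨⟨x, x.2⟩, x.1.2⟩
  invFun x := ⟨⟨x, x.2⟩, x.1.2⟩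
  left_inv _ := rfl
  right_inv _ := rfl
  map_mul' _ _ := rfl

/-- Nested subgroups with the same intersection with `F`, and meeting the same left cosets of `F`,
are equal. -/
theorem Subgroup.eq_of_le_of_subgroupOf_eq_of_image_mk_eq {G : Type*} [Group G]
    {F H K : Subgroup G} (hHK : H ≤ K) (hF : K.subgroupOf F = H.subgroupOf F)
    (hq : (QuotientGroup.mk '' (K : Set G) : Set (G ⧸ F)) = QuotientGroup.mk '' (H : Set G)) :
    K = H := by
  refine le_antisymm (fun x hx => ?_) hHK
  obtain ⟨y, hy, hyx⟩ : (x : G ⧸ F) ∈ (QuotientGroup.mk '' (H : Set G) : Set (G ⧸ F)) :=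
    hq ▸ Set.mem_image_of_mem _ hx
  -- `x` differs from an element `y` of `H` by an element of `K ⊓ F`, which lies in `H`.
  have hyxF : y⁻¹ * x ∈ F := QuotientGroup.eq.1 hyx
  have hmem : (⟨y⁻¹ * x, hyxF⟩ : F) ∈ K.subgroupOf F := K.mul_mem (K.inv_mem (hHK hy)) hx
  rw [hF] at hmem
  exact (Subgroup.mul_mem_cancel_left H (H.inv_mem hy)).1 hmem

/-- A group with a Takahasi subgroup of finite index is a Takahasi group. -/
theorem IsTakahasiGroup.of_finiteIndex {G : Type*} [Group G] (F : Subgroup G) [F.FiniteIndex]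
    (hF : IsTakahasiGroup F) : IsTakahasiGroup G := by
  rintro H _ hH ⟨M, hM⟩
  have hfg : ∀ n, Group.FG ((H n).subgroupOf F) := fun n =>
    have : Group.FG (F.subgroupOf (H n)) := Subgroup.fg_of_index_ne_zero _
    Group.fg_of_surjective (f := ((F.subgroupOfSwapEquiv (H n)).toMonoidHom))
      (F.subgroupOfSwapEquiv (H n)).surjective
  have hrank : ∀ n, Group.rank ((H n).subgroupOf F) ≤ F.index * M := fun n =>
    calc Group.rank ((H n).subgroupOf F) = Group.rank (F.subgroupOf (H n)) :=
          Group.rank_congr ((H n).subgroupOfSwapEquiv F)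
      _ ≤ F.relIndex (H n) * Group.rank (H n) := Subgroup.rank_le_index_mul_rank _
      -- Index 0 encodes infinite index, so this monotonicity needs `F.index ≠ 0`.
      _ ≤ F.index * M := Nat.mul_le_mul (by
          have h := Subgroup.relIndex_le_of_le_right (H := F) (le_top : H n ≤ ⊤)
            (by simpa using Subgroup.FiniteIndex.index_ne_zero)
          simpa using h) (hM n)
  obtain ⟨p, hp⟩ := hF (fun n => (H n).subgroupOf F)
    (fun _ _ hmn => Subgroup.comap_mono (hH hmn)) ⟨_, hrank⟩
  let cosets : ℕ →o Set (G ⧸ F) :=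
    ⟨fun n => QuotientGroup.mk '' (H n : Set G), fun _ _ hmn => Set.image_mono (hH hmn)⟩
  -- `G ⧸ F` is finite, so ascending chains of its subsets stabilise.
  obtain ⟨q, hq⟩ := WellFoundedGT.monotone_chain_condition cosets
  refine ⟨max p q, fun n hn => ?_⟩
  exact Subgroup.eq_of_le_of_subgroupOf_eq_of_image_mk_eq (F := F) (hH hn)
    ((hp n (le_of_max_le_left hn)).trans (hp _ (le_max_left p q)).symm)
    ((hq n (le_of_max_le_right hn)).symm.trans (hq _ (le_max_right p q)))

theorem corollary4p2 {G : Type*} [Group G] (hG : IsVirtuallyFree G) : IsTakahasiGroup G := by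
  obtain ⟨F, _, _⟩ := hG
  exact IsTakahasiGroup.of_finiteIndex F (IsFreeGroup.isTakahasiGroup F)
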